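/- There is a universal constant $C>0$ such that the following holds. Let $\delta\in(0,1/4]$ and let $n$ be an integer with $n\ge \frac{1}{4\delta}$. Then there is a finite (non-random) collection $\mathcal C$ of parallelepipeds in $\mathbb R^n$ (translates of sets $\{\sum_{i=1}^n t_i b_i : t_i\in[0,1]\}$ with $b_1,\dots,b_n$ a basis of $\mathbb R^n$) with $$|\mathcal C|\le \exp\Bigl(13\,n\,\delta\ln\frac{2e}{\delta}\Bigr)$$ having the following property: for every $n\times n$ random matrix $A$ (on any probability space) whose entries are independent and identically distributed real random variables with $\mathbb E a_{ij}=0$ and $\mathbb E a_{ij}^2=1$, with probability at least $1-4\exp(-\delta n/8)$ we have $$\forall\, x\in B_2^n\ \ \exists\, P\in\mathcal C\ \text{ such that }\ x\in P\ \text{ and }\ A(P)\subset Ax+\frac{C\sqrt n}{\delta}B_2^n .$$ Here $B_2^n$ is the closed unit Euclidean ball of $\mathbb R^n$. In particular $\mathcal C$ depends only on $n$ and $\delta$, and not on the distribution of $A$. -/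

import Mathlib

open MeasureTheory ProbabilityTheory

/-- A (closed, non-degenerate) parallelepiped in `ℝⁿ`: a translate of the set
`{∑ i, t i • b i : t i ∈ [0,1]}` spanned by a basis `b` of `ℝⁿ`. -/
def IsParallelepiped {n : ℕ} (P : Set (EuclideanSpace ℝ (Fin n))) : Prop :=
  ∃ (a : EuclideanSpace ℝ (Fin n))
    (b : Module.Basis (Fin n) ℝ (EuclideanSpace ℝ (Fin n))),
    P = (fun y => a + y) '' parallelepiped b

/-- The random `n × n` matrix `A` has i.i.d. real entries with mean zero and variance one. -/
structure IsIIDStandardized {Ω : Type*} [MeasurableSpace Ω] (μ : Measure Ω) {n : ℕ}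
    (A : Ω → Matrix (Fin n) (Fin n) ℝ) : Prop where
  measurable : ∀ i j, Measurable (fun ω => A ω i j)
  indep : iIndepFun (fun (p : Fin n × Fin n) ω => A ω p.1 p.2) μ
  identDistrib : ∀ i j k l, IdentDistrib (fun ω => A ω i j) (fun ω => A ω k l) μ μ
  memLp : ∀ i j, MemLp (fun ω => A ω i j) 2 μ
  mean : ∀ i j, ∫ ω, A ω i j ∂μ = 0
  second_moment : ∀ i j, ∫ ω, (A ω i j) ^ 2 ∂μ = 1

/-!
Write `L = 100 n / δ` and, for `k : Fin n → ℕ`, let `D` be the diagonal matrix with entries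
`2 ^ (-k j)`. The theorem rests on the fact that, outside an event of probability
`2 exp (-δ n / 8)`, some `k` with `∑ j, k j ≤ δ n` satisfies `‖A D y‖ ≤ 16 √(n L)` for all `y` in
the cube `[-1, 1]ⁿ`. This has two ingredients.

*Rows can be shortened cheaply* (`exists_weights`, `lintegral_rowCost_le`). Given a row `a`, put
`u j = a j ^ 2 / L` and let `m` be minimal with `∑ j, min ((m + 1) u j) 1 ≤ m + 1`. The weights
`w j = 1 / max 1 ((m + 1) u j)` satisfy `∑ j, w j * u j ≤ 1`. The failure of level `m - 1` (when
`m ≥ 1`) has the Chernoff weight `exp (s (∑ j, min (m u j) 1 - m)) ≥ 1`, so `∏ j, 1 / w j` is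
bounded by a sum over `m` of products over the coordinates, whose expectations factor. With
`exp s = L / n` that sum has expectation at most `exp (δ / 10)`. Multiplying over the rows and using
Markov's inequality, the column weights `∏ i, w i j` have product at least `exp (-δ n)` with high
probability; rounding to powers of four gives `k` with `∑ j, a i j ^ 2 * 4 ^ (-k j) ≤ 4 L` for all
rows `i` (`exists_dyadic_weights`).

*For fixed weights and a fixed sign vector, short rows make the sum subgaussian*
(`lintegral_indicator_exp_sq_sum_le`). From `exp (v - v ^ 2) ≤ 1 + v + v ^ 2`, centred independent
variables satisfy `E exp (∑ j, (c j X j - (c j X j) ^ 2)) ≤ exp (∑ j, c j ^ 2)` with no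
assumption beyond second moments. On the event `∑ j, (c j X j) ^ 2 ≤ 4 L` the subtracted term is
bounded, and integrating against a Gaussian gives
`E exp ((∑ j, c j X j) ^ 2 / (40 L)) ≤ 2` on that event. Independence of the rows makes a violation
by a given pair of weights and signs have probability at most `exp (-5 n)`, which beats the
`4 ^ n * 2 ^ n` pairs. No symmetry of the entries is needed, since the weights are fixed before
the probability is estimated.

For the covering, divide space into cubes of mesh `2 / √(δ n)`. The coarse cell of a point of the
unit ball has index of `ℓ¹`-norm at most `δ n`. Splitting the `j`-th side into `2 ^ k j` parts gives
boxes that are translates of a multiple of `D [0, 1]ⁿ`, and a generating function bounds the number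
of all boxes that arise as `k` varies (`card_boxFamily_le`).
-/

/-! ### Self-normalised exponential moments -/

theorem exp_sub_sq_le (u : ℝ) : Real.exp (u - u ^ 2) ≤ 1 + u + u ^ 2 := by
  have h1 : 1 - u + u ^ 2 ≤ Real.exp (u ^ 2 - u) := by
    have := Real.add_one_le_exp (u ^ 2 - u); linarith
  have h2 : Real.exp (u - u ^ 2) * Real.exp (u ^ 2 - u) = 1 := by
    rw [← Real.exp_add]; simp
  have h3 : 0 < 1 + u + u ^ 2 := by nlinarith [sq_nonneg (u + 1 / 2)]
  have h4 : 0 < Real.exp (u ^ 2 - u) := Real.exp_pos _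
  -- `(1 + u + u²)(1 - u + u²) = 1 + u² + u⁴`
  have h5 : 1 ≤ (1 + u + u ^ 2) * Real.exp (u ^ 2 - u) := by
    nlinarith [mul_le_mul_of_nonneg_left h1 h3.le, sq_nonneg u, sq_nonneg (u ^ 2)]
  exact le_of_mul_le_mul_right (h2.trans_le h5) h4

theorem lintegral_exp_sub_sq_le {Ω : Type*} [MeasurableSpace Ω] {μ : Measure Ω}
    [IsProbabilityMeasure μ] {X : Ω → ℝ} (hX : MemLp X 2 μ) (h0 : ∫ ω, X ω ∂μ = 0)
    (h1 : ∫ ω, X ω ^ 2 ∂μ = 1) (c : ℝ) :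
    ∫⁻ ω, ENNReal.ofReal (Real.exp (c * X ω - (c * X ω) ^ 2)) ∂μ
      ≤ ENNReal.ofReal (Real.exp (c ^ 2)) := by
  have hi : Integrable X μ := hX.integrable (by norm_num)
  have hi2 : Integrable (fun ω => X ω ^ 2) μ := hX.integrable_sq
  have hint : Integrable (fun ω => 1 + c * X ω + c ^ 2 * X ω ^ 2) μ :=
    ((integrable_const 1).add (hi.const_mul c)).add (hi2.const_mul _)
  calc ∫⁻ ω, ENNReal.ofReal (Real.exp (c * X ω - (c * X ω) ^ 2)) ∂μ
      ≤ ∫⁻ ω, ENNReal.ofReal (1 + c * X ω + c ^ 2 * X ω ^ 2) ∂μ := by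
        refine lintegral_mono fun ω => ENNReal.ofReal_le_ofReal ?_
        have := exp_sub_sq_le (c * X ω)
        rwa [mul_pow] at this ⊢
    _ = ENNReal.ofReal (∫ ω, 1 + c * X ω + c ^ 2 * X ω ^ 2 ∂μ) := by
        rw [ofReal_integral_eq_lintegral_ofReal hint]
        refine Filter.Eventually.of_forall fun ω => ?_
        have := (Real.exp_pos _).le.trans (exp_sub_sq_le (c * X ω))
        simpa [mul_pow] using this
    _ = ENNReal.ofReal (1 + c ^ 2) := by
        congr 1
        have e1 : ∫ ω, 1 + c * X ω + c ^ 2 * X ω ^ 2 ∂μ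
            = ∫ ω, 1 + c * X ω ∂μ + ∫ ω, c ^ 2 * X ω ^ 2 ∂μ :=
          integral_add ((integrable_const 1).add (hi.const_mul c)) (hi2.const_mul _)
        have e2 : ∫ ω, 1 + c * X ω ∂μ = ∫ _ω, 1 ∂μ + ∫ ω, c * X ω ∂μ :=
          integral_add (integrable_const 1) (hi.const_mul c)
        rw [e1, e2, integral_const_mul, integral_const_mul, h0, h1]
        simp
    _ ≤ _ := ENNReal.ofReal_le_ofReal (by linarith [Real.add_one_le_exp (c ^ 2)])

theorem lintegral_prod_ofReal_eq {Ω ι : Type*} [Fintype ι] [MeasurableSpace Ω] {μ : Measure Ω}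
    {E : Type*} [MeasurableSpace E] {X : ι → Ω → E} (hX : ∀ j, Measurable (X j))
    (hind : iIndepFun X μ) (f : ι → E → ℝ) (hf : ∀ j, Measurable (f j)) (hf0 : ∀ j x, 0 ≤ f j x) :
    ∫⁻ ω, ENNReal.ofReal (∏ j, f j (X j ω)) ∂μ
      = ∏ j, ∫⁻ ω, ENNReal.ofReal (f j (X j ω)) ∂μ := by
  have h := lintegral_prod_eq_prod_lintegral_of_indepFun (μ := μ) Finset.univ
    (fun j ω => ENNReal.ofReal (f j (X j ω)))
    (hind.comp (fun j x => ENNReal.ofReal (f j x)) fun j => (hf j).ennreal_ofReal)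
    (fun j => ((hf j).comp (hX j)).ennreal_ofReal)
  rw [← h]
  exact lintegral_congr fun ω => ENNReal.ofReal_prod_of_nonneg fun j _ => hf0 j _

/-- Subtracting the sum of squares in the exponent makes the exponential moment of a weighted sum
of centred independent variables subgaussian, using second moments only. -/
theorem lintegral_exp_sum_sub_sq_le {Ω ι : Type*} [Fintype ι] [MeasurableSpace Ω] {μ : Measure Ω}
    [IsProbabilityMeasure μ] {X : ι → Ω → ℝ} (hm : ∀ j, Measurable (X j))
    (hind : iIndepFun X μ) (hX : ∀ j, MemLp (X j) 2 μ) (h0 : ∀ j, ∫ ω, X j ω ∂μ = 0)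
    (h1 : ∀ j, ∫ ω, X j ω ^ 2 ∂μ = 1) (c : ι → ℝ) :
    ∫⁻ ω, ENNReal.ofReal (Real.exp (∑ j, (c j * X j ω - (c j * X j ω) ^ 2))) ∂μ
      ≤ ENNReal.ofReal (Real.exp (∑ j, c j ^ 2)) := by
  simp_rw [Real.exp_sum]
  rw [lintegral_prod_ofReal_eq hm hind (fun j x => Real.exp (c j * x - (c j * x) ^ 2))
    (fun j => by fun_prop) (fun j x => (Real.exp_pos _).le),
    ENNReal.ofReal_prod_of_nonneg fun j _ => (Real.exp_pos _).le]
  exact Finset.prod_le_prod' fun j _ => lintegral_exp_sub_sq_le (hX j) (h0 j) (h1 j) (c j)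

/-! ### Gaussian linearisation of a squared sum -/

theorem lintegral_exp_mul_gaussianReal (a : ℝ) :
    ∫⁻ g, ENNReal.ofReal (Real.exp (a * g)) ∂(gaussianReal 0 1)
      = ENNReal.ofReal (Real.exp (a ^ 2 / 2)) := by
  have h := mgf_gaussianReal (p := gaussianReal 0 1) (X := id) (μ := 0) (v := 1) (by simp) a
  rw [← ofReal_integral_eq_lintegral_ofReal (integrable_exp_mul_gaussianReal a)
    (Filter.Eventually.of_forall fun g => (Real.exp_pos _).le)]
  congr 1
  simpa [mgf] using h

theorem lintegral_exp_sq_gaussianReal_le :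
    ∫⁻ g, ENNReal.ofReal (Real.exp (g ^ 2 / 4)) ∂(gaussianReal 0 1) ≤ 2 := by
  have hpdf : ∀ g : ℝ, gaussianPDF 0 1 g * ENNReal.ofReal (Real.exp (g ^ 2 / 4))
      = ENNReal.ofReal ((√(2 * Real.pi))⁻¹ * Real.exp (-(1 / 4) * g ^ 2)) := by
    intro g
    rw [gaussianPDF, ← ENNReal.ofReal_mul (gaussianPDFReal_nonneg _ _ _), gaussianPDFReal, mul_assoc,
      ← Real.exp_add]
    congr 2
    · simp
    · congr 1; simp; ring
  rw [gaussianReal_of_var_ne_zero _ one_ne_zero,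
    lintegral_withDensity_eq_lintegral_mul _ (measurable_gaussianPDF 0 1) (by fun_prop)]
  simp only [Pi.mul_apply, hpdf]
  rw [← ofReal_integral_eq_lintegral_ofReal
    ((integrable_exp_neg_mul_sq (by norm_num : (0 : ℝ) < 1 / 4)).const_mul _)
    (Filter.Eventually.of_forall fun g => by positivity), integral_const_mul, integral_gaussian]
  rw [show (2 : ENNReal) = ENNReal.ofReal 2 by simp]
  apply ENNReal.ofReal_le_ofReal
  have hp := Real.pi_pos
  rw [inv_mul_le_iff₀ (by positivity)]
  rw [show √(2 * Real.pi) * 2 = √(8 * Real.pi) by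
    rw [show 8 * Real.pi = (2 * Real.pi) * 2 ^ 2 by ring,
      Real.sqrt_mul (x := 2 * Real.pi) (by positivity), Real.sqrt_sq (by norm_num)]]
  exact Real.sqrt_le_sqrt (by linarith)

/-- On the event that the squares of the summands add up to at most `4 L`, the sum is subgaussian
at scale `√L`. -/
theorem lintegral_indicator_exp_sq_sum_le {Ω : Type*} [MeasurableSpace Ω] {μ : Measure Ω}
    [IsProbabilityMeasure μ] {n : ℕ} {X : Fin n → Ω → ℝ} (hm : ∀ j, Measurable (X j))
    (hind : iIndepFun X μ) (hX : ∀ j, MemLp (X j) 2 μ) (h0 : ∀ j, ∫ ω, X j ω ∂μ = 0)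
    (h1 : ∀ j, ∫ ω, X j ω ^ 2 ∂μ = 1) {L : ℝ} (hL : 0 < L) (hn : n ≤ L) (c : Fin n → ℝ)
    (hc : ∀ j, c j ^ 2 ≤ 1) :
    ∫⁻ ω, {ω | ∑ j, (c j * X j ω) ^ 2 ≤ 4 * L}.indicator
      (fun ω => ENNReal.ofReal (Real.exp ((∑ j, c j * X j ω) ^ 2 / (40 * L)))) ω ∂μ ≤ 2 := by
  set τ : ℝ := √(1 / (20 * L)) with hτ
  have hτ2 : τ ^ 2 = 1 / (20 * L) := Real.sq_sqrt (by positivity)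
  have hpt : ∀ ω, {ω | ∑ j, (c j * X j ω) ^ 2 ≤ 4 * L}.indicator
      (fun ω => ENNReal.ofReal (Real.exp ((∑ j, c j * X j ω) ^ 2 / (40 * L)))) ω
      ≤ ∫⁻ g, ENNReal.ofReal (Real.exp (g ^ 2 / 5 +
        ∑ j, ((τ * g * c j) * X j ω - ((τ * g * c j) * X j ω) ^ 2))) ∂(gaussianReal 0 1) := by
    intro ω
    by_cases hω : ω ∈ {ω | ∑ j, (c j * X j ω) ^ 2 ≤ 4 * L}
    · rw [Set.indicator_of_mem hω]
      have : (∑ j, c j * X j ω) ^ 2 / (40 * L) = (τ * ∑ j, c j * X j ω) ^ 2 / 2 := by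
        rw [mul_pow, hτ2]; field_simp; ring
      rw [this, ← lintegral_exp_mul_gaussianReal]
      refine lintegral_mono fun g => ENNReal.ofReal_le_ofReal (Real.exp_le_exp.2 ?_)
      have h2 : ∑ j, ((τ * g * c j) * X j ω - ((τ * g * c j) * X j ω) ^ 2)
          = (τ * ∑ j, c j * X j ω) * g - τ ^ 2 * g ^ 2 * ∑ j, (c j * X j ω) ^ 2 := by
        rw [Finset.sum_sub_distrib, Finset.mul_sum, Finset.sum_mul, Finset.mul_sum]
        congr 1
        · exact Finset.sum_congr rfl fun j _ => by ring
        · exact Finset.sum_congr rfl fun j _ => by ring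
      have h3 : τ ^ 2 * g ^ 2 * ∑ j, (c j * X j ω) ^ 2 ≤ g ^ 2 / 5 := by
        calc τ ^ 2 * g ^ 2 * ∑ j, (c j * X j ω) ^ 2 ≤ τ ^ 2 * g ^ 2 * (4 * L) := by
              gcongr; exact hω
          _ = g ^ 2 / 5 := by rw [hτ2]; field_simp; ring
      linarith
    · rw [Set.indicator_of_notMem hω]; exact zero_le
  refine (lintegral_mono hpt).trans ?_
  rw [lintegral_lintegral_swap (by fun_prop)]
  refine le_trans (lintegral_mono fun g => ?_) lintegral_exp_sq_gaussianReal_le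
  simp_rw [Real.exp_add, ENNReal.ofReal_mul (Real.exp_pos (g ^ 2 / 5)).le]
  rw [lintegral_const_mul _ (by fun_prop)]
  refine (mul_le_mul_right (lintegral_exp_sum_sub_sq_le hm hind hX h0 h1 _) _).trans ?_
  rw [← ENNReal.ofReal_mul (Real.exp_pos _).le, ← Real.exp_add]
  refine ENNReal.ofReal_le_ofReal (Real.exp_le_exp.2 ?_)
  have h4 : ∑ j, (τ * g * c j) ^ 2 ≤ g ^ 2 / 20 := by
    calc ∑ j, (τ * g * c j) ^ 2 ≤ ∑ _j : Fin n, τ ^ 2 * g ^ 2 := by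
          refine Finset.sum_le_sum fun j _ => ?_
          rw [mul_pow, mul_pow]
          exact mul_le_of_le_one_right (by positivity) (hc j)
      _ = n * (g ^ 2 / (20 * L)) := by
          rw [hτ2, Finset.sum_const, Finset.card_univ, Fintype.card_fin, nsmul_eq_mul]; ring
      _ ≤ L * (g ^ 2 / (20 * L)) := by gcongr
      _ = g ^ 2 / 20 := by field_simp
  linarith

/-! ### Large deviations for a fixed direction -/

theorem IsIIDStandardized.indep_rows {Ω : Type*} [MeasurableSpace Ω] {μ : Measure Ω}
    [IsProbabilityMeasure μ] {n : ℕ} {A : Ω → Matrix (Fin n) (Fin n) ℝ}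
    (hA : IsIIDStandardized μ A) : iIndepFun (fun i ω => (fun j => A ω i j : Fin n → ℝ)) μ := by
  have h2 : ∀ i, iIndepFun (fun j ω => A ω i j) μ := fun i =>
    hA.indep.precomp (g := fun j => (i, j)) (fun a b h => (Prod.mk.inj h).2)
  have hp : ∀ i j, IsProbabilityMeasure (μ.map fun ω => A ω i j) := fun i j =>
    Measure.isProbabilityMeasure_map (hA.measurable i j).aemeasurable
  have hmr : ∀ i, Measurable (fun ω => (fun j => A ω i j : Fin n → ℝ)) := fun i =>
    measurable_pi_lambda _ fun j => hA.measurable i j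
  have hp' : ∀ i, IsProbabilityMeasure (μ.map fun ω => (fun j => A ω i j : Fin n → ℝ)) := fun i =>
    Measure.isProbabilityMeasure_map (hmr i).aemeasurable
  have hs : iIndepFun (fun (p : (_ : Fin n) × Fin n) ω => A ω p.1 p.2) μ :=
    hA.indep.precomp (Equiv.sigmaEquivProd (Fin n) (Fin n)).injective
  rw [iIndepFun_iff_map_fun_eq_infinitePi_map hmr]
  have hcur := Measure.infinitePi_map_piCurry (X := fun _ _ : Fin n => ℝ)
    (fun i j : Fin n => μ.map fun ω => A ω i j)
  rw [← (iIndepFun_iff_map_fun_eq_infinitePi_map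
    (fun p : (_ : Fin n) × Fin n => hA.measurable p.1 p.2)).1 hs,
    Measure.map_map (by fun_prop)
      (measurable_pi_lambda _ fun p : (_ : Fin n) × Fin n => hA.measurable p.1 p.2)] at hcur
  have e : ∀ i, μ.map (fun ω => (fun j => A ω i j : Fin n → ℝ))
      = Measure.infinitePi fun j => μ.map fun ω => A ω i j := fun i =>
    (iIndepFun_iff_map_fun_eq_infinitePi_map (hA.measurable i)).1 (h2 i)
  simp_rw [e]
  exact hcur

/-- For a fixed vector `c` of coefficients bounded by one, it is exponentially unlikely that
`A c` is long while every row, weighted by `c`, has small Euclidean norm. -/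
theorem IsIIDStandardized.measure_rows_small_and_image_large_le {Ω : Type*} [MeasurableSpace Ω]
    {μ : Measure Ω} [IsProbabilityMeasure μ] {n : ℕ} {A : Ω → Matrix (Fin n) (Fin n) ℝ}
    (hA : IsIIDStandardized μ A) {L : ℝ} (hL : 0 < L) (hn : n ≤ L) (c : Fin n → ℝ)
    (hc : ∀ j, c j ^ 2 ≤ 1) :
    μ {ω | (∀ i, ∑ j, (c j * A ω i j) ^ 2 ≤ 4 * L) ∧
        256 * n * L < ∑ i, (∑ j, c j * A ω i j) ^ 2}
      ≤ ENNReal.ofReal (Real.exp (-5 * n)) := by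
  have hrow : ∀ i, iIndepFun (fun j ω => A ω i j) μ := fun i =>
    hA.indep.precomp (g := fun j => (i, j)) (fun a b h => (Prod.mk.inj h).2)
  have hmr : ∀ i, Measurable (fun ω => (fun j => A ω i j : Fin n → ℝ)) := fun i =>
    measurable_pi_lambda _ fun j => hA.measurable i j
  set G : Set (Fin n → ℝ) := {x | ∑ j, (c j * x j) ^ 2 ≤ 4 * L} with hG
  have hGm : MeasurableSet G := measurableSet_le (by fun_prop) measurable_const
  set f : (Fin n → ℝ) → ℝ := G.indicator fun x => Real.exp ((∑ j, c j * x j) ^ 2 / (40 * L)) with hf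
  have hfm : Measurable f := Measurable.indicator (by fun_prop) hGm
  have hf0 : ∀ x, 0 ≤ f x := fun x => Set.indicator_nonneg (fun _ _ => (Real.exp_pos _).le) x
  have hprod := lintegral_prod_ofReal_eq hmr hA.indep_rows (fun _ => f) (fun _ => hfm)
    (fun _ => hf0)
  have hone : ∀ i, ∫⁻ ω, ENNReal.ofReal (f fun j => A ω i j) ∂μ ≤ 2 := by
    intro i
    refine le_trans (le_of_eq (lintegral_congr fun ω => ?_)) (lintegral_indicator_exp_sq_sum_le
      (hA.measurable i) (hrow i) (hA.memLp i) (hA.mean i) (hA.second_moment i) hL hn c hc)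
    by_cases h : ∑ j, (c j * A ω i j) ^ 2 ≤ 4 * L
    · rw [hf, Set.indicator_of_mem (show (fun j => A ω i j) ∈ G from h),
        Set.indicator_of_mem (show ω ∈ {ω | ∑ j, (c j * A ω i j) ^ 2 ≤ 4 * L} from h)]
    · rw [hf, Set.indicator_of_notMem (show (fun j => A ω i j) ∉ G from h),
        Set.indicator_of_notMem (show ω ∉ {ω | ∑ j, (c j * A ω i j) ^ 2 ≤ 4 * L} from h)]
      simp
  have hle : ∫⁻ ω, ENNReal.ofReal (∏ i, f fun j => A ω i j) ∂μ ≤ 2 ^ n := by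
    rw [hprod]
    refine (Finset.prod_le_prod' fun i _ => hone i).trans ?_
    simp
  -- on the event the product of exponentials is at least `exp (256 n / 40) ≥ exp (6 n)`
  have hmk := meas_ge_le_lintegral_div (μ := μ)
    (f := fun ω => ENNReal.ofReal (∏ i, f fun j => A ω i j))
    (by
      refine Measurable.aemeasurable (Measurable.ennreal_ofReal ?_)
      exact Finset.measurable_prod _ fun i _ => hfm.comp (hmr i))
    (ε := ENNReal.ofReal (Real.exp (6 * n))) (by simp [Real.exp_pos]) ENNReal.ofReal_ne_top
  refine (measure_mono ?_).trans (hmk.trans ?_)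
  · rintro ω ⟨h1, h2⟩
    refine ENNReal.ofReal_le_ofReal ?_
    have : ∀ i, f (fun j => A ω i j) = Real.exp ((∑ j, c j * A ω i j) ^ 2 / (40 * L)) := fun i => by
      rw [hf, Set.indicator_of_mem (show (fun j => A ω i j) ∈ G from h1 i)]
    simp_rw [this]
    rw [← Real.exp_sum, ← Finset.sum_div]
    refine Real.exp_le_exp.2 ?_
    rw [le_div_iff₀ (by positivity)]
    have : (0 : ℝ) ≤ n * L := by positivity
    nlinarith
  · refine ENNReal.div_le_of_le_mul (hle.trans ?_)
    rw [← ENNReal.ofReal_mul (Real.exp_pos _).le, ← Real.exp_add,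
      show (2 : ENNReal) = ENNReal.ofReal 2 by simp, ← ENNReal.ofReal_pow (by norm_num)]
    refine ENNReal.ofReal_le_ofReal ?_
    rw [show -5 * (n : ℝ) + 6 * n = n * 1 by ring, Real.exp_nat_mul]
    have := Real.add_one_le_exp 1
    exact pow_le_pow_left₀ (by norm_num) (by linarith) _

/-! ### Weights that shorten a row -/

/-- The contribution of one coordinate, of normalised square `u`, to the cost of truncating a row
at level `1 / (m + 1)`: the factor `max 1 ((m + 1) u)` by which the coordinate is shrunk, times the
exponential weight used to bound the probability that truncation at level `1 / m` does not
suffice. -/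
noncomputable def coordCost (s : ℝ) (m : ℕ) (u : ℝ) : ℝ :=
  max 1 ((m + 1) * u) * Real.exp (s * min (m * u) 1)

/-- An upper bound for the cost of weights that shorten the row with normalised squares `u`,
summed over all truncation levels `1 / (m + 1)`, `m < n`. -/
noncomputable def rowCost (s : ℝ) {n : ℕ} (u : Fin n → ℝ) : ℝ :=
  ∑ m ∈ Finset.range n, (∏ j, coordCost s m (u j)) * Real.exp (-(s * m))

theorem coordCost_pos (s : ℝ) (m : ℕ) (u : ℝ) : 0 < coordCost s m u :=
  mul_pos (zero_lt_one.trans_le (le_max_left _ _)) (Real.exp_pos _)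

theorem rowCost_nonneg (s : ℝ) {n : ℕ} (u : Fin n → ℝ) : 0 ≤ rowCost s u :=
  Finset.sum_nonneg fun _ _ =>
    mul_nonneg (Finset.prod_nonneg fun _ _ => (coordCost_pos _ _ _).le) (Real.exp_pos _).le

theorem measurable_coordCost (s : ℝ) (m : ℕ) : Measurable (coordCost s m) := by
  unfold coordCost; fun_prop

theorem measurable_rowCost (s : ℝ) (n : ℕ) : Measurable (rowCost s : (Fin n → ℝ) → ℝ) := by
  unfold rowCost
  refine Finset.measurable_sum _ fun m _ => Measurable.mul_const ?_ _
  exact Finset.measurable_prod _ fun j _ => (measurable_coordCost s m).comp (measurable_pi_apply j)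

/-- Any row can be shortened by weights whose total cost is at most `rowCost`: truncate at the
first level `1 / (m + 1)` at which the truncated sum is at most one. -/
theorem exists_weights {s : ℝ} (hs : 0 ≤ s) {n : ℕ} (hn : 1 ≤ n) (u : Fin n → ℝ) :
    ∃ w : Fin n → ℝ, (∀ j, 0 < w j ∧ w j ≤ 1) ∧ ∑ j, w j * u j ≤ 1 ∧
      ∏ j, (w j)⁻¹ ≤ rowCost s u := by
  classical
  have hlast : ∑ j, min (((n - 1 : ℕ) + 1 : ℝ) * u j) 1 ≤ ((n - 1 : ℕ) : ℝ) + 1 := by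
    calc ∑ j, min (((n - 1 : ℕ) + 1 : ℝ) * u j) 1 ≤ ∑ _j : Fin n, (1 : ℝ) :=
          Finset.sum_le_sum fun j _ => min_le_right _ _
      _ = ((n - 1 : ℕ) : ℝ) + 1 := by
          have : ((n - 1 + 1 : ℕ) : ℝ) = n := by rw [Nat.sub_add_cancel hn]
          push_cast at this
          simp [this]
  have hex : ∃ m : ℕ, ∑ j, min ((m + 1 : ℝ) * u j) 1 ≤ m + 1 := ⟨n - 1, hlast⟩
  set m := Nat.find hex with hm
  have hmsum : ∑ j, min ((m + 1 : ℝ) * u j) 1 ≤ m + 1 := Nat.find_spec hex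
  have hmn : m < n := by
    have : m ≤ n - 1 := Nat.find_min' hex hlast
    omega
  have hprev : (m : ℝ) ≤ ∑ j, min (m * u j) 1 := by
    rcases Nat.eq_zero_or_pos m with h0 | hpos
    · simp [h0]
    · have := Nat.find_min hex (m := m - 1) (by omega)
      have e : ((m - 1 : ℕ) : ℝ) + 1 = m := by
        have : ((m - 1 + 1 : ℕ) : ℝ) = m := by rw [Nat.sub_add_cancel hpos]
        exact_mod_cast this
      rw [e] at this
      exact (not_le.1 this).le
  have hpos : ∀ j, 0 < max 1 ((m + 1 : ℝ) * u j) := fun j => zero_lt_one.trans_le (le_max_left _ _)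
  have hm1 : (0 : ℝ) < m + 1 := by positivity
  refine ⟨fun j => (max 1 ((m + 1 : ℝ) * u j))⁻¹, fun j =>
    ⟨inv_pos.2 (hpos j), inv_le_one_of_one_le₀ (le_max_left _ _)⟩, ?_, ?_⟩
  · have hterm : ∀ j, (max 1 ((m + 1 : ℝ) * u j))⁻¹ * u j
        = (min ((m + 1 : ℝ) * u j) 1) / (m + 1) := by
      intro j
      rcases le_total ((m + 1 : ℝ) * u j) 1 with h | h
      · rw [max_eq_left h, min_eq_left h]; field_simp
      · rw [max_eq_right h, min_eq_right h]
        have : u j ≠ 0 := by rintro h0; rw [h0] at h; norm_num at h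
        field_simp
    rw [Finset.sum_congr rfl fun j _ => hterm j, ← Finset.sum_div, div_le_one hm1]
    exact hmsum
  · simp only [inv_inv]
    refine le_trans ?_ (Finset.single_le_sum (f := fun m : ℕ =>
      (∏ j, coordCost s m (u j)) * Real.exp (-(s * m))) (fun _ _ =>
        mul_nonneg (Finset.prod_nonneg fun _ _ => (coordCost_pos _ _ _).le) (Real.exp_pos _).le)
      (Finset.mem_range.2 hmn))
    simp only [coordCost]
    rw [Finset.prod_mul_distrib, ← Real.exp_sum, mul_assoc, ← Real.exp_add, ← Finset.mul_sum]
    refine le_mul_of_one_le_right (Finset.prod_nonneg fun j _ => (hpos j).le) ?_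
    refine Real.one_le_exp ?_
    nlinarith [mul_le_mul_of_nonneg_left hprev hs]

theorem coordCost_le {s : ℝ} (hs : 0 ≤ s) (m : ℕ) {u : ℝ} (hu : 0 ≤ u) :
    coordCost s m u ≤ 1 + Real.exp s * (m + 1) * u := by
  have hm : (0 : ℝ) ≤ m := Nat.cast_nonneg m
  unfold coordCost
  rcases le_total ((m + 1) * u) 1 with h | h
  · rw [max_eq_left h, one_mul]
    set v := min (m * u) 1 with hv
    have hv0 : 0 ≤ v := le_min (by positivity) zero_le_one
    have hv1 : v ≤ 1 := min_le_right _ _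
    have hvm : v ≤ (m + 1) * u := (min_le_left _ _).trans (by nlinarith)
    -- convexity of the exponential between `0` and `s`
    have hconv := convexOn_exp.2 (Set.mem_univ 0) (Set.mem_univ s) (sub_nonneg.2 hv1) hv0 (by ring)
    simp only [smul_eq_mul, mul_zero, zero_add, Real.exp_zero, mul_one] at hconv
    rw [mul_comm s v]
    nlinarith [Real.exp_pos s, mul_le_mul_of_nonneg_left hvm (Real.exp_pos s).le]
  · rw [max_eq_right h]
    have : Real.exp (s * min (m * u) 1) ≤ Real.exp s :=
      Real.exp_le_exp.2 (mul_le_of_le_one_right hs (min_le_right _ _))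
    nlinarith [mul_le_mul_of_nonneg_left this (zero_le_one.trans h)]

theorem coordCost_zero_le (s : ℝ) {u : ℝ} (hu : 0 ≤ u) : coordCost s 0 u ≤ 1 + u := by
  unfold coordCost
  simp only [Nat.cast_zero, zero_add, one_mul, zero_mul, min_eq_left zero_le_one, mul_zero,
    Real.exp_zero, mul_one]
  exact max_le (by linarith) (by linarith)

/-- The expected cost of shortening a row of independent entries is barely above one. -/
theorem lintegral_rowCost_le {Ω : Type*} [MeasurableSpace Ω] {μ : Measure Ω}
    [IsProbabilityMeasure μ] {n : ℕ} {X : Fin n → Ω → ℝ} (hm : ∀ j, Measurable (X j))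
    (hind : iIndepFun X μ) (hX : ∀ j, MemLp (X j) 2 μ) (h1 : ∀ j, ∫ ω, X j ω ^ 2 ∂μ = 1)
    {η L : ℝ} (hη : 0 < η) (hη1 : η ≤ 1 / 400) (hL : 0 < L) (hnL : n / L = η) :
    ∫⁻ ω, ENNReal.ofReal (rowCost (Real.log (1 / η)) fun j => X j ω ^ 2 / L) ∂μ
      ≤ ENNReal.ofReal (Real.exp (10 * η)) := by
  set s := Real.log (1 / η) with hs
  have hs0 : 0 ≤ s := Real.log_nonneg (by rw [le_div_iff₀ hη]; linarith)
  have hes : Real.exp s = 1 / η := Real.exp_log (by positivity)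
  have hi2 : ∀ j, Integrable (fun ω => X j ω ^ 2) μ := fun j => (hX j).integrable_sq
  -- one coordinate
  have hcoord : ∀ (m : ℕ) (K : ℝ), 0 ≤ K → (∀ u : ℝ, 0 ≤ u → coordCost s m u ≤ 1 + K * u) → ∀ j,
      ∫⁻ ω, ENNReal.ofReal (coordCost s m (X j ω ^ 2 / L)) ∂μ
        ≤ ENNReal.ofReal (Real.exp (K / L)) := by
    intro m K hK hle j
    have hint : Integrable (fun ω => 1 + K / L * X j ω ^ 2) μ :=
      (integrable_const 1).add ((hi2 j).const_mul _)
    calc ∫⁻ ω, ENNReal.ofReal (coordCost s m (X j ω ^ 2 / L)) ∂μ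
        ≤ ∫⁻ ω, ENNReal.ofReal (1 + K / L * X j ω ^ 2) ∂μ := by
          refine lintegral_mono fun ω => ENNReal.ofReal_le_ofReal ?_
          refine (hle _ (by positivity)).trans (le_of_eq ?_)
          ring
      _ = ENNReal.ofReal (∫ ω, 1 + K / L * X j ω ^ 2 ∂μ) := by
          rw [ofReal_integral_eq_lintegral_ofReal hint]
          exact Filter.Eventually.of_forall fun ω => by positivity
      _ = ENNReal.ofReal (1 + K / L) := by
          congr 1
          have e1 : ∫ ω, 1 + K / L * X j ω ^ 2 ∂μ
              = ∫ _ω, 1 ∂μ + ∫ ω, K / L * X j ω ^ 2 ∂μ :=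
            integral_add (integrable_const 1) ((hi2 j).const_mul _)
          rw [e1, integral_const_mul, h1]
          simp
      _ ≤ _ := ENNReal.ofReal_le_ofReal (by linarith [Real.add_one_le_exp (K / L)])
  have hprod : ∀ (m : ℕ) (K : ℝ), 0 ≤ K → (∀ u : ℝ, 0 ≤ u → coordCost s m u ≤ 1 + K * u) →
      ∫⁻ ω, ENNReal.ofReal (∏ j, coordCost s m (X j ω ^ 2 / L)) ∂μ
        ≤ ENNReal.ofReal (Real.exp (K * η)) := by
    intro m K hK hle
    rw [lintegral_prod_ofReal_eq hm hind (fun _ x => coordCost s m (x ^ 2 / L))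
      (fun _ => (measurable_coordCost s m).comp (by fun_prop)) (fun _ _ => (coordCost_pos _ _ _).le)]
    refine (Finset.prod_le_prod' fun j _ => hcoord m K hK hle j).trans (le_of_eq ?_)
    rw [Finset.prod_const, Finset.card_univ, Fintype.card_fin,
      ← ENNReal.ofReal_pow (Real.exp_pos _).le, ← Real.exp_nat_mul, ← hnL]
    congr 2
    ring
  -- the term of index `m` is geometrically small
  have hterm : ∀ m : ℕ,
      ∫⁻ ω, ENNReal.ofReal ((∏ j, coordCost s m (X j ω ^ 2 / L)) * Real.exp (-(s * m))) ∂μ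
        ≤ ENNReal.ofReal (if m = 0 then Real.exp η else Real.exp 1 * (Real.exp 1 * η) ^ m) := by
    intro m
    have hpn : ∀ ω, 0 ≤ ∏ j, coordCost s m (X j ω ^ 2 / L) := fun ω =>
      Finset.prod_nonneg fun _ _ => (coordCost_pos _ _ _).le
    have hmeas : Measurable fun ω => ENNReal.ofReal (∏ j, coordCost s m (X j ω ^ 2 / L)) := by
      refine Measurable.ennreal_ofReal (Finset.measurable_prod _ fun j _ => ?_)
      exact (measurable_coordCost s m).comp (((hm j).pow_const 2).div_const L)
    simp_rw [ENNReal.ofReal_mul (hpn _)]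
    rw [lintegral_mul_const _ hmeas]
    split_ifs with h0
    · subst h0
      have := hprod 0 1 zero_le_one fun u hu => by simpa using coordCost_zero_le s hu
      simpa using this
    · have h := hprod m (Real.exp s * (m + 1)) (by positivity) fun u hu => coordCost_le hs0 m hu
      refine (mul_le_mul_left h _).trans (le_of_eq ?_)
      rw [← ENNReal.ofReal_mul (Real.exp_pos _).le, hes]
      congr 1
      have e1 : 1 / η * (m + 1) * η = (m : ℝ) * 1 + 1 := by field_simp
      have e2 : Real.exp (-(s * m)) = η ^ m := by
        rw [show -(s * m) = (m : ℝ) * (-s) by ring, Real.exp_nat_mul, Real.exp_neg, hes]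
        simp
      rw [e1, e2, Real.exp_add, Real.exp_nat_mul, mul_pow]
      ring
  set q := Real.exp 1 * η with hq
  have hq0 : 0 < q := by positivity
  have he : Real.exp 1 < 2.7182818286 := Real.exp_one_lt_d9
  have hqη : q ≤ 2.72 * η := by rw [hq]; gcongr; linarith
  have hq1 : q ≤ 0.01 := by linarith
  calc ∫⁻ ω, ENNReal.ofReal (rowCost s fun j => X j ω ^ 2 / L) ∂μ
      = ∑ m ∈ Finset.range n, ∫⁻ ω, ENNReal.ofReal
          ((∏ j, coordCost s m (X j ω ^ 2 / L)) * Real.exp (-(s * m))) ∂μ := by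
        rw [← lintegral_finsetSum]
        · refine lintegral_congr fun ω => ?_
          rw [rowCost, ENNReal.ofReal_sum_of_nonneg]
          exact fun m _ => mul_nonneg (Finset.prod_nonneg fun _ _ => (coordCost_pos _ _ _).le)
            (Real.exp_pos _).le
        · intro m _
          refine Measurable.ennreal_ofReal
            (Measurable.mul_const (Finset.measurable_prod _ fun j _ => ?_) _)
          exact (measurable_coordCost s m).comp (((hm j).pow_const 2).div_const L)
    _ ≤ ∑ m ∈ Finset.range n,
          ENNReal.ofReal (if m = 0 then Real.exp η else Real.exp 1 * q ^ m) :=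
        Finset.sum_le_sum fun m _ => hterm m
    _ ≤ ∑ m ∈ Finset.range (n + 1),
          ENNReal.ofReal (if m = 0 then Real.exp η else Real.exp 1 * q ^ m) :=
        Finset.sum_le_sum_of_subset (Finset.range_mono (Nat.le_succ n))
    _ = ENNReal.ofReal (∑ m ∈ Finset.range (n + 1),
          if m = 0 then Real.exp η else Real.exp 1 * q ^ m) := by
        rw [ENNReal.ofReal_sum_of_nonneg]
        intro m _
        split_ifs <;> positivity
    _ ≤ _ := by
        refine ENNReal.ofReal_le_ofReal ?_
        rw [Finset.sum_range_succ']
        simp only [Nat.add_eq_zero_iff, one_ne_zero, and_false, if_false, if_true]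
        have hgeom : ∑ m ∈ Finset.range n, Real.exp 1 * q ^ (m + 1) ≤ Real.exp 1 * (q / (1 - q)) := by
          rw [← Finset.mul_sum]
          refine mul_le_mul_of_nonneg_left ?_ (Real.exp_pos _).le
          simp_rw [pow_succ]
          rw [← Finset.sum_mul, div_eq_inv_mul]
          refine mul_le_mul_of_nonneg_right ?_ hq0.le
          rw [← tsum_geometric_of_lt_one hq0.le (by linarith)]
          exact (summable_geometric_of_lt_one hq0.le (by linarith)).sum_le_tsum _
            fun _ _ => by positivity
        have hdiv : q / (1 - q) ≤ 2.8 * η := by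
          rw [div_le_iff₀ (by linarith)]
          nlinarith
        have hexp : Real.exp η ≤ 1 + 1.1 * η := by
          have := Real.abs_exp_sub_one_sub_id_le (x := η) (by rw [abs_of_pos hη]; linarith)
          have := (abs_le.1 this).2
          nlinarith
        have := Real.add_one_le_exp (10 * η)
        have h3 : Real.exp 1 * (q / (1 - q)) ≤ 2.8 * (2.8 * η) := by
          have : 0 ≤ q / (1 - q) := div_nonneg hq0.le (by linarith)
          gcongr
          linarith
        linarith

/-- With overwhelming probability all rows can be shortened at the total cost `exp (δ n)`. -/
theorem IsIIDStandardized.measure_prod_rowCost_gt_le {Ω : Type*} [MeasurableSpace Ω]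
    {μ : Measure Ω} [IsProbabilityMeasure μ] {n : ℕ} {A : Ω → Matrix (Fin n) (Fin n) ℝ}
    (hA : IsIIDStandardized μ A) {δ : ℝ} (hδ : 0 < δ) (hδ1 : δ ≤ 1 / 4) (hn : 1 ≤ n) :
    μ {ω | Real.exp (δ * n) <
        ∏ i, rowCost (Real.log (1 / (δ / 100))) fun j => A ω i j ^ 2 / (100 * n / δ)}
      ≤ ENNReal.ofReal (Real.exp (-(δ * n / 8))) := by
  have hn0 : (0 : ℝ) < n := by exact_mod_cast hn
  have hmr : ∀ i, Measurable (fun ω => (fun j => A ω i j : Fin n → ℝ)) := fun i =>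
    measurable_pi_lambda _ fun j => hA.measurable i j
  have hrow : ∀ i, iIndepFun (fun j ω => A ω i j) μ := fun i =>
    hA.indep.precomp (g := fun j => (i, j)) (fun a b h => (Prod.mk.inj h).2)
  set f : (Fin n → ℝ) → ℝ :=
    fun x => rowCost (Real.log (1 / (δ / 100))) fun j => x j ^ 2 / (100 * n / δ) with hf
  have hfm : Measurable f := (measurable_rowCost _ n).comp
    (measurable_pi_lambda _ fun j => by fun_prop)
  have hprod := lintegral_prod_ofReal_eq hmr hA.indep_rows (fun _ => f) (fun _ => hfm)
    (fun _ _ => rowCost_nonneg _ _)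
  have hle : ∫⁻ ω, ENNReal.ofReal (∏ i, f fun j => A ω i j) ∂μ
      ≤ ENNReal.ofReal (Real.exp (δ * n / 10)) := by
    rw [hprod]
    refine (Finset.prod_le_prod' fun i _ => lintegral_rowCost_le (hA.measurable i) (hrow i)
      (hA.memLp i) (hA.second_moment i) (η := δ / 100) (by positivity) (by linarith)
      (L := 100 * n / δ) (by positivity) (by field_simp)).trans (le_of_eq ?_)
    rw [Finset.prod_const, Finset.card_univ, Fintype.card_fin,
      ← ENNReal.ofReal_pow (Real.exp_pos _).le, ← Real.exp_nat_mul]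
    congr 2
    ring
  have hmk := meas_ge_le_lintegral_div (μ := μ)
    (f := fun ω => ENNReal.ofReal (∏ i, f fun j => A ω i j))
    (Measurable.aemeasurable (Measurable.ennreal_ofReal
      (Finset.measurable_prod _ fun i _ => hfm.comp (hmr i))))
    (ε := ENNReal.ofReal (Real.exp (δ * n))) (by simp [Real.exp_pos]) ENNReal.ofReal_ne_top
  refine (measure_mono fun ω hω => ?_).trans (hmk.trans ?_)
  · exact ENNReal.ofReal_le_ofReal (le_of_lt hω)
  · refine ENNReal.div_le_of_le_mul (hle.trans ?_)
    rw [← ENNReal.ofReal_mul (Real.exp_pos _).le, ← Real.exp_add]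
    refine ENNReal.ofReal_le_ofReal (Real.exp_le_exp.2 ?_)
    have : 0 < δ * n := by positivity
    linarith

/-- If the rows of a matrix can be shortened at a small total cost, dyadic column weights
`2 ^ (-k j)` of small total exponent make all rows short at once. -/
theorem exists_dyadic_weights {s : ℝ} (hs : 0 ≤ s) {n : ℕ} (hn : 1 ≤ n)
    (B : Matrix (Fin n) (Fin n) ℝ) {L M : ℝ} (hL : 0 < L)
    (h : ∏ i, rowCost s (fun j => B i j ^ 2 / L) ≤ Real.exp M) :
    ∃ k : Fin n → ℕ, ∑ j, (k j : ℝ) ≤ M ∧ ∀ i, ∑ j, ((1 / 2) ^ k j * B i j) ^ 2 ≤ 4 * L := by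
  choose w hw01 hwsum hwprod using fun i =>
    exists_weights hs hn (fun j => B i j ^ 2 / L)
  set W : Fin n → ℝ := fun j => ∏ i, (w i j)⁻¹ with hW
  have hwinv : ∀ i j, 1 ≤ (w i j)⁻¹ := fun i j =>
    (one_le_inv₀ (hw01 i j).1).2 (hw01 i j).2
  have hW1 : ∀ j, 1 ≤ W j := fun j => Finset.one_le_prod fun i _ => hwinv i j
  choose k hk1 hk2 using fun j => exists_nat_pow_near (hW1 j) (by norm_num : (1 : ℝ) < 4)
  have hprod : ∏ j, W j ≤ Real.exp M := by
    rw [hW, Finset.prod_comm]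
    exact (Finset.prod_le_prod (fun i _ => Finset.prod_nonneg fun j _ =>
      zero_le_one.trans (hwinv i j)) fun i _ => hwprod i).trans h
  refine ⟨k, ?_, fun i => ?_⟩
  · have h4 : Real.exp (∑ j, (k j : ℝ)) ≤ Real.exp M := by
      rw [Real.exp_sum]
      refine (Finset.prod_le_prod (fun j _ => (Real.exp_pos _).le) fun j _ => ?_).trans hprod
      refine le_trans ?_ (hk1 j)
      have : Real.exp (k j) = Real.exp 1 ^ k j := by rw [← Real.exp_nat_mul, mul_one]
      rw [this]
      have he : Real.exp 1 < 2.7182818286 := Real.exp_one_lt_d9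
      exact pow_le_pow_left₀ (Real.exp_pos _).le (by linarith) _
    exact Real.exp_le_exp.1 h4
  · have hterm : ∀ j, ((1 / 2) ^ k j * B i j) ^ 2 ≤ 4 * L * (w i j * (B i j ^ 2 / L)) := by
      intro j
      have hwW : (w i j)⁻¹ ≤ W j := by
        rw [hW]
        beta_reduce
        rw [← Finset.mul_prod_erase _ _ (Finset.mem_univ i)]
        exact le_mul_of_one_le_right (zero_le_one.trans (hwinv i j))
          (Finset.one_le_prod fun i' _ => hwinv i' j)
      have h1 : (w i j)⁻¹ ≤ 4 ^ (k j + 1) := hwW.trans (hk2 j).le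
      have h2 : ((1 / 2 : ℝ) ^ k j) ^ 2 ≤ 4 * w i j := by
        have e : ((1 / 2 : ℝ) ^ k j) ^ 2 = (4 ^ k j)⁻¹ := by
          rw [← pow_mul, mul_comm, pow_mul, ← inv_pow]; norm_num
        rw [e, inv_le_comm₀ (by positivity) (by have := (hw01 i j).1; positivity), mul_inv]
        rw [pow_succ] at h1
        linarith
      rw [mul_pow]
      calc _ ≤ 4 * w i j * B i j ^ 2 := by gcongr
        _ = _ := by field_simp
    calc ∑ j, ((1 / 2) ^ k j * B i j) ^ 2 ≤ ∑ j, 4 * L * (w i j * (B i j ^ 2 / L)) :=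
          Finset.sum_le_sum fun j _ => hterm j
      _ = 4 * L * ∑ j, w i j * (B i j ^ 2 / L) := by rw [Finset.mul_sum]
      _ ≤ 4 * L := mul_le_of_le_one_right (by positivity) (hwsum i)

/-! ### Counting labels by generating functions -/

theorem card_filter_sum_le {ι : Type*} [DecidableEq ι] (I : Finset ι) (h : ι → ℕ) (n : ℕ) {x M : ℝ}
    (hx : 0 < x) (hx1 : x ≤ 1) :
    (((Fintype.piFinset fun _ : Fin n => I).filter fun p => ((∑ j, h (p j) : ℕ) : ℝ) ≤ M).card : ℝ)
      ≤ x ^ (-M) * (∑ a ∈ I, x ^ h a) ^ n := by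
  rw [Finset.card_eq_sum_ones, Nat.cast_sum]
  have hprod : (∑ a ∈ I, x ^ h a) ^ n = ∑ p ∈ Fintype.piFinset fun _ : Fin n => I,
      ∏ j, x ^ h (p j) := by
    rw [← Finset.prod_univ_sum (fun _ : Fin n => I) fun _ a => x ^ h a]; simp
  rw [hprod, Finset.mul_sum]
  refine (Finset.sum_le_sum fun p hp => ?_).trans
    (Finset.sum_le_sum_of_subset_of_nonneg (Finset.filter_subset _ _) fun p _ _ => by positivity)
  rw [Finset.prod_pow_eq_pow_sum, ← Real.rpow_natCast, ← Real.rpow_add hx]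
  simp only [Nat.cast_one]
  exact Real.one_le_rpow_of_pos_of_le_one_of_nonpos hx hx1
    (by linarith [(Finset.mem_filter.1 hp).2])

theorem sum_pow_range_le {x : ℝ} (hx : 0 ≤ x) (hx1 : x ≤ 1 / 2) (N : ℕ) :
    ∑ k ∈ Finset.range N, x ^ k ≤ 1 + 2 * x := by
  have h1 : ∑ k ∈ Finset.range N, x ^ k ≤ (1 - x)⁻¹ := by
    rw [← tsum_geometric_of_lt_one hx (by linarith)]
    exact (summable_geometric_of_lt_one hx (by linarith)).sum_le_tsum _ fun _ _ => by positivity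
  refine h1.trans ?_
  rw [inv_le_iff_one_le_mul₀ (by linarith)]
  nlinarith

theorem sum_pow_natAbs_le {x : ℝ} (hx : 0 ≤ x) (hx1 : x ≤ 1 / 2) (N : ℕ) :
    ∑ q ∈ Finset.Icc (-N : ℤ) N, x ^ q.natAbs ≤ 1 + 4 * x := by
  have hsub : Finset.Icc (-N : ℤ) N ⊆
      (Finset.range (N + 1)).image (fun k : ℕ => (k : ℤ)) ∪
        (Finset.range N).image (fun k : ℕ => -((k + 1 : ℕ) : ℤ)) := by
    intro q hq
    rw [Finset.mem_Icc] at hq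
    rw [Finset.mem_union, Finset.mem_image, Finset.mem_image]
    rcases le_or_gt 0 q with h | h
    · exact Or.inl ⟨q.toNat, by rw [Finset.mem_range]; omega, by omega⟩
    · exact Or.inr ⟨(-q - 1).toNat, by rw [Finset.mem_range]; omega, by omega⟩
  have h0 : ∀ q : ℤ, 0 ≤ x ^ q.natAbs := fun q => by positivity
  refine (Finset.sum_le_sum_of_subset_of_nonneg hsub fun q _ _ => h0 q).trans ?_
  rw [Finset.sum_union (by
    rw [Finset.disjoint_left]
    intro q h1 h2
    obtain ⟨a, -, rfl⟩ := Finset.mem_image.1 h1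
    obtain ⟨b, -, hb⟩ := Finset.mem_image.1 h2
    omega), Finset.sum_image (by intro a _ b _ h; simpa using h),
    Finset.sum_image (by intro a _ b _ h; simpa using h)]
  simp only [Int.natAbs_natCast, Int.natAbs_neg, pow_succ]
  rw [← Finset.sum_mul]
  have h1 := sum_pow_range_le hx hx1 (N + 1)
  have h2 := sum_pow_range_le hx hx1 N
  nlinarith

/-! ### Boxes of a dyadically refined grid -/

/-- Labels of intervals: a refinement level `k`, the index `q` of a coarse cell, and the position
`r` of one of the `2 ^ k` equal parts of that cell. -/
abbrev CellLabel := (_ : ℕ × ℤ) × ℕ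

/-- Labels of refinement level at most `N` inside the coarse cells of index at most `N`. -/
noncomputable def cellLabels (N : ℕ) : Finset CellLabel :=
  (Finset.range (N + 1) ×ˢ Finset.Icc (-N : ℤ) N).sigma fun p => Finset.range (2 ^ p.1)

/-- The weight of a label: refinement level plus distance of the coarse cell from the origin. -/
def cellWeight (p : CellLabel) : ℕ := p.1.1 + p.1.2.natAbs

theorem sum_pow_cellWeight_le {x : ℝ} (hx : 0 ≤ x) (hx1 : x ≤ 1 / 4) (N : ℕ) :
    ∑ p ∈ cellLabels N, x ^ cellWeight p ≤ Real.exp (8 * x) := by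
  have h : ∑ p ∈ cellLabels N, x ^ cellWeight p
      = (∑ k ∈ Finset.range (N + 1), (2 * x) ^ k) * ∑ q ∈ Finset.Icc (-N : ℤ) N, x ^ q.natAbs := by
    rw [cellLabels, Finset.sum_sigma, Finset.sum_product, Finset.sum_mul_sum]
    refine Finset.sum_congr rfl fun k _ => Finset.sum_congr rfl fun q _ => ?_
    simp [cellWeight, pow_add, mul_pow]
    ring
  rw [h, show 8 * x = 4 * x + 4 * x by ring, Real.exp_add]
  refine mul_le_mul ?_ ?_ (Finset.sum_nonneg fun q _ => by positivity) (Real.exp_pos _).le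
  · have := sum_pow_range_le (x := 2 * x) (by linarith) (by linarith) (N + 1)
    linarith [Real.add_one_le_exp (4 * x)]
  · have := sum_pow_natAbs_le hx (by linarith) N
    linarith [Real.add_one_le_exp (4 * x)]

/-- The left end of the interval with a given label, in the grid of mesh `t`. -/
noncomputable def cellLeft (t : ℝ) (p : CellLabel) : ℝ :=
  t * (p.1.2 - 1 / 2 + p.2 * (1 / 2) ^ p.1.1)

/-- The product of the intervals with the given labels, in the grid of mesh `t`. -/
def cellBox (t : ℝ) {n : ℕ} (p : Fin n → CellLabel) : Set (EuclideanSpace ℝ (Fin n)) :=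
  {z | ∀ j, cellLeft t (p j) ≤ z j ∧ z j ≤ cellLeft t (p j) + t * (1 / 2) ^ (p j).1.1}

theorem isParallelepiped_box {n : ℕ} (a c : Fin n → ℝ) (hc : ∀ j, 0 < c j) :
    IsParallelepiped {z : EuclideanSpace ℝ (Fin n) | ∀ j, a j ≤ z j ∧ z j ≤ a j + c j} := by
  set b := (EuclideanSpace.basisFun (Fin n) ℝ).toBasis.isUnitSMul
    (fun j => (hc j).ne'.isUnit) with hb
  have hbj : ∀ t : Fin n → ℝ, ∑ j, t j • b j = WithLp.toLp 2 fun j => t j * c j := by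
    intro t
    ext i
    simp [hb, Module.Basis.isUnitSMul_apply, Pi.single_apply]
  refine ⟨WithLp.toLp 2 a, b, ?_⟩
  ext z
  simp only [Set.mem_ofPred_eq, Set.mem_image, mem_parallelepiped_iff, hbj]
  constructor
  · intro h
    refine ⟨WithLp.toLp 2 fun j => z j - a j, ⟨fun j => (z j - a j) / c j,
      ⟨fun j => ?_, fun j => ?_⟩, ?_⟩, ?_⟩
    · exact div_nonneg (by linarith [(h j).1]) (hc j).le
    · exact (div_le_one (hc j)).2 (by linarith [(h j).2])
    · ext j
      simp [div_mul_cancel₀ _ (hc j).ne']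
    · ext j; simp
  · rintro ⟨y, ⟨s, ⟨hs0, hs1⟩, rfl⟩, rfl⟩ j
    have h0 := mul_nonneg (hs0 j) (hc j).le
    have h1 := mul_le_of_le_one_left (hc j).le (hs1 j)
    simp only [PiLp.add_apply]
    constructor <;> linarith

theorem isParallelepiped_cellBox {t : ℝ} (ht : 0 < t) {n : ℕ} (p : Fin n → CellLabel) :
    IsParallelepiped (cellBox t p) :=
  isParallelepiped_box (fun j => cellLeft t (p j)) (fun j => t * (1 / 2) ^ (p j).1.1)
    fun j => by positivity

/-- Every real number lies in an interval of any prescribed refinement level, in a coarse cell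
whose index is controlled by its square. -/
theorem exists_cellLabel {t : ℝ} (ht : 0 < t) (k : ℕ) (y : ℝ) :
    ∃ p : CellLabel, p.1.1 = k ∧ p.2 < 2 ^ k ∧ (p.1.2.natAbs : ℝ) ≤ 4 * (y / t) ^ 2 ∧
      cellLeft t p ≤ y ∧ y ≤ cellLeft t p + t * (1 / 2) ^ k := by
  set v : ℝ := y / t with hv
  set q : ℤ := round v with hq
  have hq1 := abs_le.1 (abs_sub_round v)
  set f : ℝ := v - q + 1 / 2 with hf
  have hf0 : 0 ≤ f := by linarith [hq1.1]
  have hf1 : f ≤ 1 := by linarith [hq1.2]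
  have hK : (0 : ℝ) < 2 ^ k := by positivity
  have hinv : ((1 : ℝ) / 2) ^ k * 2 ^ k = 1 := by rw [← mul_pow]; norm_num
  have hy : y = t * v := by rw [hv]; field_simp
  have hnat : (q.natAbs : ℝ) ≤ 4 * v ^ 2 := by
    have h1 : (q.natAbs : ℝ) ≤ (q : ℝ) ^ 2 := by
      have : (q.natAbs : ℤ) ≤ q ^ 2 := by
        rw [Int.natCast_natAbs, ← sq_abs]
        exact Int.le_self_sq |q|
      have h : (((q.natAbs : ℤ) : ℝ)) ≤ ((q ^ 2 : ℤ) : ℝ) := Int.cast_le.2 this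
      rwa [Int.cast_natCast, Int.cast_pow] at h
    -- a nonzero rounded value is at most twice as large as the number itself
    have h2 : (q : ℝ) ^ 2 ≤ 4 * v ^ 2 := by
      rcases lt_trichotomy q 0 with h | h | h
      · have : (q : ℝ) ≤ -1 := by exact_mod_cast (by omega : q ≤ -1)
        nlinarith [hq1.2]
      · rw [h]; simp; positivity
      · have : (1 : ℝ) ≤ q := by exact_mod_cast h
        nlinarith [hq1.1]
    exact h1.trans h2
  -- the position of `v` inside its coarse cell; the right end belongs to the last part
  obtain ⟨r, hr, hr0, hr1⟩ : ∃ r : ℕ, r < 2 ^ k ∧ (r : ℝ) ≤ f * 2 ^ k ∧ f * 2 ^ k ≤ r + 1 := by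
    rcases hf1.lt_or_eq with h | h
    · refine ⟨⌊f * 2 ^ k⌋₊, ?_, Nat.floor_le (by positivity), (Nat.lt_floor_add_one _).le⟩
      rw [Nat.floor_lt (by positivity)]
      push_cast
      exact mul_lt_of_lt_one_left hK h
    · have h1 : 1 ≤ 2 ^ k := Nat.one_le_two_pow
      have h2 : ((2 ^ k - 1 : ℕ) : ℝ) = 2 ^ k - 1 := by push_cast [Nat.cast_sub h1]; ring
      exact ⟨2 ^ k - 1, by omega, by rw [h2, h]; linarith, by rw [h2, h]; linarith⟩
  have hr0' : (r : ℝ) * (1 / 2) ^ k ≤ f := by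
    have := mul_le_mul_of_nonneg_right hr0 (by positivity : (0 : ℝ) ≤ (1 / 2) ^ k)
    rwa [mul_assoc, mul_comm (2 ^ k), hinv, mul_one] at this
  have hr1' : f ≤ (r + 1) * (1 / 2) ^ k := by
    have := mul_le_mul_of_nonneg_right hr1 (by positivity : (0 : ℝ) ≤ (1 / 2) ^ k)
    rwa [mul_assoc, mul_comm (2 ^ k), hinv, mul_one] at this
  refine ⟨⟨(k, q), r⟩, rfl, hr, hnat, ?_, ?_⟩
  · rw [hy, cellLeft]
    exact mul_le_mul_of_nonneg_left (by dsimp only; linarith) ht.le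
  · rw [hy, cellLeft, ← mul_add]
    exact mul_le_mul_of_nonneg_left (by dsimp only; linarith) ht.le

/-- The boxes of bounded total weight, in the grid of mesh `t`. -/
noncomputable def boxFamily (t M : ℝ) (n : ℕ) : Finset (Set (EuclideanSpace ℝ (Fin n))) := by
  classical
  exact ((Fintype.piFinset fun _ : Fin n => cellLabels n).filter fun p =>
    ((∑ j, cellWeight (p j) : ℕ) : ℝ) ≤ M).image (cellBox t)

theorem isParallelepiped_of_mem_boxFamily {t M : ℝ} (ht : 0 < t) {n : ℕ}
    {P : Set (EuclideanSpace ℝ (Fin n))} (hP : P ∈ boxFamily t M n) : IsParallelepiped P := by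
  classical
  obtain ⟨p, -, rfl⟩ := Finset.mem_image.1 hP
  exact isParallelepiped_cellBox ht p

theorem card_boxFamily_le {δ : ℝ} (hδ : 0 < δ) (hδ1 : δ ≤ 1 / 4) (t : ℝ) (n : ℕ) :
    ((boxFamily t (2 * (δ * n)) n).card : ℝ)
      ≤ Real.exp (13 * n * δ * Real.log (2 * Real.exp 1 / δ)) := by
  classical
  have h1 : ((boxFamily t (2 * (δ * n)) n).card : ℝ) ≤ _ :=
    (Nat.cast_le.2 Finset.card_image_le).trans
      (card_filter_sum_le (cellLabels n) cellWeight n (x := δ / 2) (by positivity) (by linarith))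
  refine h1.trans ?_
  have h2 : (∑ p ∈ cellLabels n, (δ / 2) ^ cellWeight p) ^ n ≤ Real.exp (n * (8 * (δ / 2))) := by
    rw [Real.exp_nat_mul]
    exact pow_le_pow_left₀ (Finset.sum_nonneg fun _ _ => by positivity)
      (sum_pow_cellWeight_le (by positivity) (by linarith) n) n
  have hlog : Real.log (2 * Real.exp 1 / δ) = 1 - Real.log (δ / 2) := by
    rw [show 2 * Real.exp 1 / δ = Real.exp 1 / (δ / 2) by field_simp,
      Real.log_div (Real.exp_pos _).ne' (by positivity), Real.log_exp]
  have hneg : Real.log (δ / 2) ≤ 0 := Real.log_nonpos (by positivity) (by linarith)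
  rw [Real.rpow_def_of_pos (by positivity)]
  refine (mul_le_mul_of_nonneg_left h2 (Real.exp_pos _).le).trans ?_
  rw [← Real.exp_add, hlog]
  refine Real.exp_le_exp.2 ?_
  have : 0 ≤ δ * n := by positivity
  nlinarith [mul_nonneg this (neg_nonneg.2 hneg)]

/-- For every refinement profile `k` of small total exponent, each point of the unit ball lies in a
box of the family with side lengths `t * 2 ^ (-k j)`. -/
theorem exists_mem_boxFamily {t M : ℝ} (ht : 0 < t) {n : ℕ} (hM : 4 / t ^ 2 ≤ M) (hMn : M ≤ n)
    (k : Fin n → ℕ) (hk : ∑ j, (k j : ℝ) ≤ M) {x : EuclideanSpace ℝ (Fin n)} (hx : ‖x‖ ≤ 1) :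
    ∃ P ∈ boxFamily t (2 * M) n, x ∈ P ∧ ∀ y ∈ P, ∀ j, |y j - x j| ≤ t * (1 / 2) ^ k j := by
  classical
  choose p hp1 hp2 hp3 hp4 hp5 using fun j => exists_cellLabel ht (k j) (x j)
  have hx2 : ∑ j, x j ^ 2 ≤ 1 := by
    have := EuclideanSpace.norm_sq_eq x
    simp only [Real.norm_eq_abs, sq_abs] at this
    rw [← this]
    exact pow_le_one₀ (norm_nonneg _) hx
  have hq : ∑ j, ((p j).1.2.natAbs : ℝ) ≤ M := by
    calc ∑ j, ((p j).1.2.natAbs : ℝ) ≤ ∑ j, 4 * (x j / t) ^ 2 := Finset.sum_le_sum fun j _ => hp3 j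
      _ = 4 / t ^ 2 * ∑ j, x j ^ 2 := by
          rw [Finset.mul_sum]; exact Finset.sum_congr rfl fun j _ => by ring
      _ ≤ 4 / t ^ 2 := mul_le_of_le_one_right (by positivity) hx2
      _ ≤ M := hM
  have hkn : ∀ j, k j ≤ n := fun j => by
    have : (k j : ℝ) ≤ n := (Finset.single_le_sum (f := fun j => (k j : ℝ))
      (fun _ _ => Nat.cast_nonneg _) (Finset.mem_univ j)).trans (hk.trans hMn)
    exact_mod_cast this
  have hqn : ∀ j, (p j).1.2.natAbs ≤ n := fun j => by
    have : ((p j).1.2.natAbs : ℝ) ≤ n := (Finset.single_le_sum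
      (f := fun j => ((p j).1.2.natAbs : ℝ)) (fun _ _ => Nat.cast_nonneg _)
      (Finset.mem_univ j)).trans (hq.trans hMn)
    exact_mod_cast this
  refine ⟨cellBox t p, Finset.mem_image.2 ⟨p, Finset.mem_filter.2 ⟨?_, ?_⟩, rfl⟩, ?_, ?_⟩
  · rw [Fintype.mem_piFinset]
    intro j
    rw [cellLabels, Finset.mem_sigma, Finset.mem_product, Finset.mem_range, Finset.mem_Icc,
      Finset.mem_range, hp1 j]
    have := hqn j
    exact ⟨⟨by have := hkn j; omega, by omega, by omega⟩, hp2 j⟩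
  · push_cast [cellWeight]
    rw [Finset.sum_add_distrib]
    simp only [hp1]
    linarith
  · intro j
    rw [hp1 j]
    exact ⟨hp4 j, hp5 j⟩
  · intro y hy j
    have h1 := hy j
    rw [hp1 j] at h1
    have h2 := hp4 j
    have h3 := hp5 j
    rw [abs_le]
    constructor <;> linarith [h1.1, h1.2]

/-! ### From sign vectors to the cube -/

/-- A bound for the Euclidean norm of the image on all sign vectors, with weights `c`, extends to
the box of half side lengths `c` by convexity. -/
theorem norm_toEuclideanLin_le_of_signs {n : ℕ} (B : Matrix (Fin n) (Fin n) ℝ) (c : Fin n → ℝ)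
    (hc : ∀ j, 0 < c j) {R : ℝ} (hR : 0 ≤ R)
    (h : ∀ ε : Fin n → Bool, ∑ i, (∑ j, (c j * if ε j then 1 else -1) * B i j) ^ 2 ≤ R ^ 2)
    {y : EuclideanSpace ℝ (Fin n)} {t : ℝ} (ht : 0 < t) (hy : ∀ j, |y j| ≤ t * c j) :
    ‖Matrix.toEuclideanLin B y‖ ≤ t * R := by
  set z : Fin n → ℝ := fun j => y j / (t * c j) with hz
  have hzmem : z ∈ convexHull ℝ (Set.univ.pi fun _ : Fin n => ({-1, 1} : Set ℝ)) := by
    rw [convexHull_pi]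
    intro j _
    rw [convexHull_pair, segment_eq_Icc (by norm_num)]
    have htc : 0 < t * c j := mul_pos ht (hc j)
    have := abs_le.1 (hy j)
    constructor
    · rw [hz]; beta_reduce; rw [le_div_iff₀ htc]; linarith
    · rw [hz]; beta_reduce; rw [div_le_one htc]; exact this.2
  let T : (Fin n → ℝ) →ₗ[ℝ] EuclideanSpace ℝ (Fin n) :=
    { toFun := fun u => Matrix.toEuclideanLin B (WithLp.toLp 2 fun j => c j * u j)
      map_add' := fun u v => by
        rw [← map_add]; congr 1; ext j; simp [mul_add]
      map_smul' := fun a u => by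
        rw [RingHom.id_apply, ← map_smul]; congr 1; ext j; simp; ring }
  have hsub : Set.univ.pi (fun _ : Fin n => ({-1, 1} : Set ℝ)) ⊆
      T ⁻¹' Metric.closedBall (0 : EuclideanSpace ℝ (Fin n)) R := by
    intro u hu
    rw [Set.mem_preimage, mem_closedBall_zero_iff]
    refine (sq_le_sq₀ (norm_nonneg _) hR).1 ?_
    rw [EuclideanSpace.norm_sq_eq]
    refine le_trans (le_of_eq (Finset.sum_congr rfl fun i _ => ?_)) (h fun j => u j = 1)
    rw [Real.norm_eq_abs, sq_abs]
    congr 1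
    simp only [T, LinearMap.coe_mk, AddHom.coe_mk, Matrix.toLpLin_apply, Matrix.mulVec, dotProduct]
    refine Finset.sum_congr rfl fun j _ => ?_
    have : u j = if u j = 1 then 1 else -1 := by
      rcases hu j (Set.mem_univ j) with h | h
      · rw [h]; norm_num
      · rw [h]; norm_num
    rw [mul_comm]
    congr 2
    simpa using this
  have hT := convexHull_min hsub ((convex_closedBall _ _).linear_preimage T) hzmem
  rw [Set.mem_preimage, mem_closedBall_zero_iff] at hT
  have hyT : Matrix.toEuclideanLin B y = t • T z := by
    change _ = t • Matrix.toEuclideanLin B _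
    rw [← map_smul]
    congr 1
    ext j
    have := (hc j).ne'
    simp only [hz, PiLp.smul_apply, smul_eq_mul]
    field_simp
  rw [hyT, norm_smul, Real.norm_of_nonneg ht.le]
  exact mul_le_mul_of_nonneg_left hT ht.le

/-! ### The uniform estimate over all dyadic weights -/

/-- The dyadic exponents of total at most `M`. -/
noncomputable def exponents (M : ℝ) (n : ℕ) : Finset (Fin n → ℕ) :=
  (Fintype.piFinset fun _ : Fin n => Finset.range (n + 1)).filter fun k =>
    ((∑ j, k j : ℕ) : ℝ) ≤ M

theorem mem_exponents {M : ℝ} {n : ℕ} (hMn : M ≤ n) {k : Fin n → ℕ} :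
    k ∈ exponents M n ↔ ∑ j, (k j : ℝ) ≤ M := by
  rw [exponents, Finset.mem_filter, Fintype.mem_piFinset]
  push_cast
  refine ⟨fun h => h.2, fun h => ⟨fun j => ?_, h⟩⟩
  have : (k j : ℝ) ≤ n := (Finset.single_le_sum (f := fun j => (k j : ℝ))
    (fun _ _ => Nat.cast_nonneg _) (Finset.mem_univ j)).trans (h.trans hMn)
  rw [Finset.mem_range]
  have : k j ≤ n := by exact_mod_cast this
  omega

theorem card_exponents_le {M : ℝ} {n : ℕ} (hMn : M ≤ n) : ((exponents M n).card : ℝ) ≤ 4 ^ n := by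
  refine (card_filter_sum_le (Finset.range (n + 1)) id n (x := 1 / 2) (by norm_num)
    (by norm_num)).trans ?_
  have h1 : ((1 : ℝ) / 2) ^ (-M) ≤ 2 ^ n := by
    rw [one_div, Real.inv_rpow (by norm_num), Real.rpow_neg (by norm_num), inv_inv,
      ← Real.rpow_natCast]
    exact Real.rpow_le_rpow_of_exponent_le (by norm_num) hMn
  have h2 : ∑ a ∈ Finset.range (n + 1), ((1 : ℝ) / 2) ^ id a ≤ 2 := by
    have := sum_pow_range_le (x := 1 / 2) (by norm_num) le_rfl (n + 1)
    simp only [id]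
    linarith
  calc _ ≤ (2 : ℝ) ^ n * 2 ^ n := by gcongr
    _ = 4 ^ n := by rw [← mul_pow]; norm_num

/-- The event that some dyadic weights of total exponent at most `M` bring the norm of the matrix,
as a map from the cube to Euclidean space, down to at most `√V`.
Only the sign vectors are tested, which keeps the event measurable and suffices by convexity. -/
def normalizedEvent {Ω : Type*} {n : ℕ} (A : Ω → Matrix (Fin n) (Fin n) ℝ) (M V : ℝ) : Set Ω :=
  ⋃ k ∈ exponents M n, ⋂ ε : Fin n → Bool,
    {ω | ∑ i, (∑ j, ((1 / 2) ^ k j * if ε j then 1 else -1) * A ω i j) ^ 2 ≤ V}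

theorem IsIIDStandardized.measurableSet_normalizedEvent {Ω : Type*} [MeasurableSpace Ω]
    {μ : Measure Ω} {n : ℕ} {A : Ω → Matrix (Fin n) (Fin n) ℝ} (hA : IsIIDStandardized μ A)
    (M V : ℝ) : MeasurableSet (normalizedEvent A M V) := by
  refine Finset.measurableSet_biUnion _ fun k _ => MeasurableSet.iInter fun ε =>
    measurableSet_le ?_ measurable_const
  refine Finset.measurable_sum _ fun i _ => Measurable.pow_const ?_ 2
  exact Finset.measurable_sum _ fun j _ => (hA.measurable i j).const_mul _

theorem IsIIDStandardized.measure_compl_normalizedEvent_le {Ω : Type*} [MeasurableSpace Ω]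
    {μ : Measure Ω} [IsProbabilityMeasure μ] {n : ℕ} {A : Ω → Matrix (Fin n) (Fin n) ℝ}
    (hA : IsIIDStandardized μ A) {δ : ℝ} (hδ : 0 < δ) (hδ1 : δ ≤ 1 / 4) (hn : 1 ≤ n) :
    μ (normalizedEvent A (δ * n) (256 * n * (100 * n / δ)))ᶜ
      ≤ ENNReal.ofReal (2 * Real.exp (-(δ * n / 8))) := by
  have hn0 : (0 : ℝ) < n := by exact_mod_cast hn
  set L : ℝ := 100 * n / δ with hL
  have hL0 : 0 < L := by positivity
  have hnL : (n : ℝ) ≤ L := by rw [hL, le_div_iff₀ hδ]; nlinarith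
  have hMn : δ * n ≤ n := by nlinarith
  set s : ℝ := Real.log (1 / (δ / 100)) with hs
  have hs0 : 0 ≤ s := Real.log_nonneg (by rw [le_div_iff₀ (by positivity)]; linarith)
  set c : (Fin n → ℕ) → (Fin n → Bool) → Fin n → ℝ :=
    fun k ε j => (1 / 2) ^ k j * if ε j then 1 else -1 with hcdef
  have hsign : ∀ b : Bool, ((if b then 1 else -1 : ℝ)) ^ 2 = 1 := by intro b; cases b <;> norm_num
  have hc2 : ∀ k ε j, c k ε j ^ 2 ≤ 1 := fun k ε j => by
    rw [hcdef]; beta_reduce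
    rw [mul_pow, hsign, mul_one]
    exact pow_le_one₀ (by positivity) (pow_le_one₀ (by norm_num) (by norm_num))
  set Bad : Set Ω := {ω | Real.exp (δ * n) < ∏ i, rowCost s fun j => A ω i j ^ 2 / L} with hBad
  set Big : (Fin n → ℕ) → (Fin n → Bool) → Set Ω := fun k ε =>
    {ω | (∀ i, ∑ j, (c k ε j * A ω i j) ^ 2 ≤ 4 * L) ∧
      256 * n * L < ∑ i, (∑ j, c k ε j * A ω i j) ^ 2} with hBig
  have hcover : (normalizedEvent A (δ * n) (256 * n * L))ᶜ
      ⊆ Bad ∪ ⋃ p ∈ exponents (δ * n) n ×ˢ (Finset.univ : Finset (Fin n → Bool)), Big p.1 p.2 := by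
    intro ω hω
    by_cases hb : ω ∈ Bad
    · exact Or.inl hb
    · right
      obtain ⟨k, hk, hrow⟩ := exists_dyadic_weights hs0 hn (A ω) hL0 (not_lt.1 hb)
      have hkm := (mem_exponents hMn).2 hk
      simp only [normalizedEvent, Set.compl_iUnion, Set.mem_iInter, Set.mem_compl_iff,
        not_forall] at hω
      obtain ⟨ε, hε⟩ := hω k hkm
      refine Set.mem_biUnion (x := (k, ε)) (by simpa using hkm) ⟨fun i => ?_, not_le.1 hε⟩
      refine le_trans (le_of_eq (Finset.sum_congr rfl fun j _ => ?_)) (hrow i)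
      rw [hcdef]; beta_reduce
      rw [mul_pow, mul_pow, mul_pow, hsign, mul_one]
  have hunion : μ (⋃ p ∈ exponents (δ * n) n ×ˢ (Finset.univ : Finset (Fin n → Bool)), Big p.1 p.2)
      ≤ ENNReal.ofReal (Real.exp (-(δ * n / 8))) := by
    refine (measure_biUnion_finset_le _ _).trans ?_
    refine (Finset.sum_le_sum fun p _ =>
      hA.measure_rows_small_and_image_large_le hL0 hnL (c p.1 p.2) (hc2 p.1 p.2)).trans ?_
    rw [Finset.sum_const, nsmul_eq_mul, ← ENNReal.ofReal_natCast,
      ← ENNReal.ofReal_mul (Nat.cast_nonneg _)]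
    refine ENNReal.ofReal_le_ofReal ?_
    have hcard : (((exponents (δ * n) n ×ˢ (Finset.univ : Finset (Fin n → Bool))).card : ℕ) : ℝ)
        ≤ Real.exp (4 * n) := by
      rw [Finset.card_product, Nat.cast_mul]
      have e1 : (((Finset.univ : Finset (Fin n → Bool)).card : ℕ) : ℝ) = 2 ^ n := by
        simp
      have h2 : (2 : ℝ) ≤ Real.exp 1 := by linarith [Real.add_one_le_exp (1 : ℝ)]
      have e2 : Real.exp (4 * n) = (Real.exp 1 ^ 4) ^ n := by
        rw [← Real.exp_nat_mul, ← Real.exp_nat_mul]; congr 1; push_cast; ring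
      rw [e1, e2]
      calc _ ≤ (4 : ℝ) ^ n * 2 ^ n := by gcongr; exact card_exponents_le hMn
        _ = 8 ^ n := by rw [← mul_pow]; norm_num
        _ ≤ _ := by
          refine pow_le_pow_left₀ (by norm_num) ?_ _
          have := pow_le_pow_left₀ (by norm_num) h2 4
          linarith
    refine (mul_le_mul_of_nonneg_right hcard (Real.exp_pos _).le).trans ?_
    rw [← Real.exp_add]
    refine Real.exp_le_exp.2 ?_
    linarith
  calc _ ≤ μ Bad + μ (⋃ p ∈ exponents (δ * n) n ×ˢ (Finset.univ : Finset (Fin n → Bool)),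
        Big p.1 p.2) := (measure_mono hcover).trans (measure_union_le _ _)
    _ ≤ ENNReal.ofReal (Real.exp (-(δ * n / 8))) + ENNReal.ofReal (Real.exp (-(δ * n / 8))) :=
        add_le_add (hA.measure_prod_rowCost_gt_le hδ hδ1 hn) hunion
    _ = _ := by rw [← ENNReal.ofReal_add (Real.exp_pos _).le (Real.exp_pos _).le, two_mul]

/-! ### The covering -/

theorem theoremA :
    ∃ C : ℝ, 0 < C ∧
      ∀ δ : ℝ, 0 < δ → δ ≤ 1 / 4 → ∀ n : ℕ, 1 / (4 * δ) ≤ (n : ℝ) →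
        ∃ 𝒞 : Finset (Set (EuclideanSpace ℝ (Fin n))),
          (∀ P ∈ 𝒞, IsParallelepiped P) ∧
          (𝒞.card : ℝ) ≤ Real.exp (13 * n * δ * Real.log (2 * Real.exp 1 / δ)) ∧
          ∀ (Ω : Type*) [MeasurableSpace Ω] (μ : Measure Ω) [IsProbabilityMeasure μ]
            (A : Ω → Matrix (Fin n) (Fin n) ℝ), IsIIDStandardized μ A →
            ∃ E : Set Ω, MeasurableSet E ∧
              1 - 4 * Real.exp (-(δ * n / 8)) ≤ μ.real E ∧
              ∀ ω ∈ E, ∀ x ∈ Metric.closedBall (0 : EuclideanSpace ℝ (Fin n)) 1,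
                ∃ P ∈ 𝒞, x ∈ P ∧
                  (Matrix.toEuclideanLin (A ω)) '' P ⊆
                    Metric.closedBall (Matrix.toEuclideanLin (A ω) x) (C * √(n : ℝ) / δ) := by
  refine ⟨320, by norm_num, fun δ hδ hδ1 n hnδ => ?_⟩
  have hn0 : (0 : ℝ) < n := lt_of_lt_of_le (by positivity) hnδ
  have hn : 1 ≤ n := by exact_mod_cast hn0
  have hMn : δ * n ≤ n := by nlinarith
  -- the mesh makes the coarse cells of points of the unit ball have total index at most `δ n`
  set t : ℝ := 2 / √(δ * n) with ht
  have hδn : 0 < δ * n := by positivity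
  have ht0 : 0 < t := by positivity
  have ht2 : t ^ 2 = 4 / (δ * n) := by rw [ht, div_pow, Real.sq_sqrt hδn.le]; norm_num
  refine ⟨boxFamily t (2 * (δ * n)) n, fun P hP => isParallelepiped_of_mem_boxFamily ht0 hP,
    card_boxFamily_le hδ hδ1 t n, ?_⟩
  intro Ω _ μ _ A hA
  have hEm := hA.measurableSet_normalizedEvent (δ * n) (256 * n * (100 * n / δ))
  refine ⟨_, hEm, ?_, ?_⟩
  · have hcompl := hA.measure_compl_normalizedEvent_le hδ hδ1 hn
    have h1 := ENNReal.toReal_mono ENNReal.ofReal_ne_top hcompl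
    rw [ENNReal.toReal_ofReal (by positivity)] at h1
    have h2 := measureReal_compl (μ := μ) hEm
    rw [probReal_univ, Measure.real] at h2
    linarith [Real.exp_pos (-(δ * n / 8))]
  · intro ω hω x hx
    obtain ⟨k, hk, hkε⟩ : ∃ k ∈ exponents (δ * n) n, ∀ ε : Fin n → Bool,
        ∑ i, (∑ j, ((1 / 2) ^ k j * if ε j then 1 else -1) * A ω i j) ^ 2
          ≤ 256 * n * (100 * n / δ) := by
      simpa [normalizedEvent] using hω
    have hM : 4 / t ^ 2 ≤ δ * n := by rw [ht2]; field_simp; exact le_rfl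
    obtain ⟨P, hP, hxP, hdiam⟩ := exists_mem_boxFamily ht0 hM hMn k ((mem_exponents hMn).1 hk)
      (mem_closedBall_zero_iff.1 hx)
    refine ⟨P, hP, hxP, ?_⟩
    rintro _ ⟨y, hy, rfl⟩
    set R : ℝ := 160 * n / √δ with hR
    have hR2 : R ^ 2 = 256 * n * (100 * n / δ) := by
      rw [hR, div_pow, Real.sq_sqrt hδ.le]; ring
    rw [mem_closedBall_iff_norm, ← map_sub]
    refine (norm_toEuclideanLin_le_of_signs (A ω) (fun j => (1 / 2) ^ k j)
      (fun j => by positivity) (R := R) (by positivity) (by rw [hR2]; exact hkε) ht0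
      (hdiam y hy)).trans (le_of_eq ?_)
    rw [ht, hR, Real.sqrt_mul hδ.le]
    have h1 : √δ * √δ = δ := Real.mul_self_sqrt hδ.le
    have h2 : √(n : ℝ) * √n = n := Real.mul_self_sqrt hn0.le
    have h3 : 0 < √δ := Real.sqrt_pos.2 hδ
    have h4 : 0 < √(n : ℝ) := Real.sqrt_pos.2 hn0
    rw [div_mul_div_comm, div_eq_div_iff (by positivity) hδ.ne']
    calc 2 * (160 * n) * δ = 320 * (√n * √n) * (√δ * √δ) := by rw [h1, h2]; ring
      _ = _ := by ring
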